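/- Let $\mathcal X$ be an Archimedean real vector lattice, and write $X^-=-(X\wedge 0)$. A net $(X_\alpha)\subset\mathcal X$ converges in order to $X$, written $X_\alpha\xrightarrow{o}X$, if there is a net $(Y_\beta)\subset\mathcal X$, possibly over a different index set, with $Y_\beta\downarrow 0$ such that for every $\beta$ there is $\alpha_0$ with $|X_\alpha-X|\le Y_\beta$ for all $\alpha\ge\alpha_0$. It converges in unbounded order (uo) to $X$ if $|X_\alpha-X|\wedge Y\xrightarrow{o}0$ for every $Y\in\mathcal X$ with $Y\ge 0$. Let $\mathcal X_n^\sim$ be the vector lattice of all linear functionals $\varphi:\mathcal X\to\mathbb R$ such that $X_\alpha\xrightarrow{o}X$ implies $\varphi(X_\alpha)\to\varphi(X)$, ordered by $\varphi\le\psi$ iff $\varphi(X)\le\psi(X)$ for all $X\ge0$. An ideal $\mathcal I\subset\mathcal X_n^\sim$ is a linear subspace such that $\varphi\in\mathcal I$, $\psi\in\mathcal X_n^\sim$ and $|\psi|\le|\varphi|$ imply $\psi\in\mathcal I$. A set $\mathcal I\subset\mathcal X_n^\sim$ is separating if for all $X\neq Y$ in $\mathcal X$ there is $\varphi\in\mathcal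 I$ with $\varphi(X)\ne\varphi(Y)$, and $\sigma(\mathcal X,\mathcal I)$ is the coarsest topology on $\mathcal X$ that makes every $\varphi\in\mathcal I$ continuous. A functional $\rho:\mathcal X\to\mathbb R\cup\{\infty\}$ is monotone if $X\ge Y$ implies $\rho(X)\le\rho(Y)$; quasiconvex if $\rho(\lambda X+(1-\lambda)Y)\le\max(\rho(X),\rho(Y))$ for all $X,Y\in\mathcal X$ and $\lambda\in[0,1]$; surplus invariant if $\rho(X)=\rho(-X^-)$ for all $X$; surplus invariant subject to positivity if $\rho(X)>0$ implies $\rho(X)=\rho(-X^-)$; and, for $S\in\mathcal X$ with $S\ge 0$ and $S\neq 0$, $S$-additive if $\rho(X+mS)=\rho(X)-m$ for all $X\in\mathcal X$ and $m\in\mathbb R$. It has the Fatou property (respectively, the super Fatou property) if $\rho(X)\le\liminf_\alpha\rho(X_\alpha)$ whenever a net $(X_\alpha)$ converges to $X$ in order (respectively, in unbounded order). Theorem. Let $\rho:\mathcal X\to\mathbb R\cup\{\infty\}$ be a functional such that (1) $\rho$ is quasiconvex, surplus invariant and monotone, or (2) $\rho$ is convex, $S$-additive for some $S\in\mathcal X$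 with $S\ge0$ and $S\ne0$, monotone, and surplus invariant subject to positivity. Then the following are equivalent: (a) $\rho$ has the Fatou property; (b) $\rho$ has the super Fatou property. If $\mathcal X_n^\sim$ is separating, then (a) and (b) are also equivalent to each of: (c) $\rho$ is $\sigma(\mathcal X,\mathcal I)$-lower semicontinuous for every separating ideal $\mathcal I\subset\mathcal X_n^\sim$; (d) $\rho$ is $\sigma(\mathcal X,\mathcal I)$-lower semicontinuous for some separating ideal $\mathcal I\subset\mathcal X_n^\sim$. -/

import Mathlib

open Filter Topology

/-- The Archimedean property of a vector lattice: if `x, y ≥ 0` and `n x ≤ y` for every natural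
number `n`, then `x = 0`. (Mathlib's `Archimedean` is a different, much stronger, property when the
order is not total.) -/
def ArchimedeanLattice (X : Type*) [AddCommGroup X] [Lattice X] : Prop :=
  ∀ x y : X, 0 ≤ x → 0 ≤ y → (∀ n : ℕ, n • x ≤ y) → x = 0

section Convergence

/-- Order convergence of a net `x` to `a`: there is a net `y`, possibly over a different directed
index set, such that `y` decreases to `0` and every `y β` eventually dominates `|x α - a|`.
(Letting the index set of `y` range over the universe of `X` is no restriction, as only the
range of `y` matters.) -/
def OrderConverges.{u, v} {X : Type u} [AddCommGroup X] [Lattice X]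
    {ι : Type v} [Preorder ι] (x : ι → X) (a : X) : Prop :=
  ∃ (κ : Type u) (_ : Preorder κ) (_ : IsDirectedOrder κ) (_ : Nonempty κ) (y : κ → X),
    Antitone y ∧ IsGLB (Set.range y) 0 ∧ ∀ β : κ, ∃ α₀ : ι, ∀ α, α₀ ≤ α → |x α - a| ≤ y β

/-- Unbounded-order convergence of a net. -/
def UOConverges.{u, v} {X : Type u} [AddCommGroup X] [Lattice X]
    {ι : Type v} [Preorder ι] (x : ι → X) (a : X) : Prop :=
  ∀ y : X, 0 ≤ y → OrderConverges (fun α => |x α - a| ⊓ y) 0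

end Convergence

section Functionals

variable {X : Type*} [AddCommGroup X] [Module ℝ X] [Lattice X]

/-- `ρ` is monotone (decreasing, in the sense of risk measures). -/
def MonotoneFunctional (ρ : X → EReal) : Prop :=
  ∀ x y : X, y ≤ x → ρ x ≤ ρ y

/-- `ρ` is quasiconvex. -/
def QuasiconvexFunctional (ρ : X → EReal) : Prop :=
  ∀ (x y : X) (t : ℝ), 0 ≤ t → t ≤ 1 → ρ (t • x + (1 - t) • y) ≤ max (ρ x) (ρ y)

/-- `ρ` is convex (used for functionals that never take the value `-∞`; in `EReal` one has
`0 * ∞ = 0`). -/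
def ConvexFunctional (ρ : X → EReal) : Prop :=
  ∀ (x y : X) (t : ℝ), 0 ≤ t → t ≤ 1 →
    ρ (t • x + (1 - t) • y) ≤ (t : EReal) * ρ x + ((1 - t : ℝ) : EReal) * ρ y

/-- `ρ` is `S`-additive. -/
def SAdditive (S : X) (ρ : X → EReal) : Prop :=
  ∀ (x : X) (m : ℝ), ρ (x + m • S) = ρ x - (m : EReal)

/-- `ρ` is surplus invariant. -/
def SurplusInvariant (ρ : X → EReal) : Prop :=
  ∀ x : X, ρ x = ρ (-x⁻)

/-- `ρ` is surplus invariant subject to positivity. -/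
def SurplusInvariantSubjectToPositivity (ρ : X → EReal) : Prop :=
  ∀ x : X, 0 < ρ x → ρ x = ρ (-x⁻)

/-- The Fatou property: lower semicontinuity along order-convergent nets. (Nets indexed by the
universe of `X` are enough: a net can be replaced by the net of pairs `z ∈ F`, with `F` in its
filter of tails on `X`.) -/
def FatouProperty.{u} {X : Type u} [AddCommGroup X] [Lattice X] (ρ : X → EReal) : Prop :=
  ∀ (ι : Type u) [Preorder ι] [IsDirectedOrder ι] [Nonempty ι] (x : ι → X) (a : X),
    OrderConverges x a → ρ a ≤ liminf (fun α => ρ (x α)) atTop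

/-- The super Fatou property: lower semicontinuity along unbounded-order convergent nets. -/
def SuperFatouProperty.{u} {X : Type u} [AddCommGroup X] [Lattice X] (ρ : X → EReal) : Prop :=
  ∀ (ι : Type u) [Preorder ι] [IsDirectedOrder ι] [Nonempty ι] (x : ι → X) (a : X),
    UOConverges x a → ρ a ≤ liminf (fun α => ρ (x α)) atTop

end Functionals

section Dual

/-- A linear functional is order continuous if it maps order-convergent nets to convergent nets. -/
def OrderContinuousFunctional.{u} {X : Type u} [AddCommGroup X] [Module ℝ X] [Lattice X]
    (φ : X →ₗ[ℝ] ℝ) : Prop :=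
  ∀ (ι : Type u) [Preorder ι] [IsDirectedOrder ι] [Nonempty ι] (x : ι → X) (a : X),
    OrderConverges x a → Tendsto (fun α => φ (x α)) atTop (𝓝 (φ a))

/-- The order-continuous dual of `X`. -/
def orderContinuousDual (X : Type*) [AddCommGroup X] [Module ℝ X] [Lattice X] :
    Submodule ℝ (X →ₗ[ℝ] ℝ) where
  carrier := {φ | OrderContinuousFunctional φ}
  add_mem' := by
    intro φ ψ hφ hψ ι _ _ _ x a h
    exact (hφ ι x a h).add (hψ ι x a h)
  zero_mem' := by
    intro ι _ _ _ x a _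
    exact tendsto_const_nhds
  smul_mem' := by
    intro c φ hφ ι _ _ _ x a h
    exact (hφ ι x a h).const_mul c

variable {X : Type*} [AddCommGroup X] [Module ℝ X] [Lattice X] [IsOrderedAddMonoid X]

/-- The order of the order-continuous dual: `φ ≤ ψ` iff `ψ - φ` is a positive functional. -/
instance orderContinuousDual.instPartialOrder : PartialOrder (orderContinuousDual X) where
  le φ ψ := ∀ x : X, 0 ≤ x → φ.1 x ≤ ψ.1 x
  le_refl _ _ _ := le_rfl
  le_trans _ _ _ h₁ h₂ x hx := (h₁ x hx).trans (h₂ x hx)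
  le_antisymm φ ψ h₁ h₂ := by
    apply Subtype.ext
    apply LinearMap.ext
    intro x
    rw [← posPart_sub_negPart x, map_sub, map_sub,
      le_antisymm (h₁ _ (posPart_nonneg x)) (h₂ _ (posPart_nonneg x)),
      le_antisymm (h₁ _ (negPart_nonneg x)) (h₂ _ (negPart_nonneg x))]

/-- `μ` is the modulus `|φ| = φ ∨ (-φ)` of `φ` in the vector lattice `orderContinuousDual X`. -/
def IsModulus (φ μ : orderContinuousDual X) : Prop :=
  IsLUB {φ, -φ} μ

/-- `I` is an ideal of the order-continuous dual, that is, a linear subspace that is solid: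
`φ ∈ I` and `|ψ| ≤ |φ|` imply `ψ ∈ I`. (In an Archimedean vector lattice every element of the
order-continuous dual has a modulus, by the Riesz-Kantorovich formulas.) -/
def IsDualIdeal (I : Submodule ℝ (orderContinuousDual X)) : Prop :=
  ∀ φ ψ μ ν : orderContinuousDual X, IsModulus φ μ → IsModulus ψ ν →
    φ ∈ I → ν ≤ μ → ψ ∈ I

/-- `I` separates the points of `X`. -/
def SeparatesPoints (I : Submodule ℝ (orderContinuousDual X)) : Prop :=
  ∀ x y : X, x ≠ y → ∃ φ ∈ I, φ.1 x ≠ φ.1 y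

/-- The canonical pairing `(x, φ) ↦ φ x` of `X` with a subspace of its order-continuous dual. -/
def dualPairing (I : Submodule ℝ (orderContinuousDual X)) : X →ₗ[ℝ] I →ₗ[ℝ] ℝ :=
  ((orderContinuousDual X).subtype ∘ₗ I.subtype).flip

/-- Lower semicontinuity with respect to the weak topology `σ(X, I)`, which is the topology of
`WeakBilin (dualPairing I)`. -/
def SigmaLSC (I : Submodule ℝ (orderContinuousDual X)) (ρ : X → EReal) : Prop :=
  LowerSemicontinuous (fun x : WeakBilin (dualPairing I) => ρ x)

end Dual

-- The value of a monotone, surplus invariant `ρ` at `a` is decided by `a⁻`, and `ρ` does not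
-- increase when `a⁻` is replaced by something smaller. If `x` converges to `a` in unbounded order,
-- testing against `a⁻` shows that the truncations `(x i)⁻ ⊓ a⁻` converge to `a⁻` in order, and `ρ
-- (-((x i)⁻ ⊓ a⁻)) ≤ ρ (x i)`. So Fatou gives super Fatou.
--
-- For weak lower semicontinuity, convexity of a sublevel set reduces weak closedness to closedness
-- for the seminorms `μ |x|` with `0 ≤ μ ∈ I`: a functional separating for such a seminorm is
-- dominated by a multiple of `μ`, hence lies in the ideal (`FatouProperty.sigmaLSC`). Seminorm
-- closedness concerns the solid, order closed set `D` of losses `x` with `ρ (-x) ≤ m`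
-- (`mem_of_forall_exists_lt`). On an interval `[0, z]` where one `μ` is strictly positive,
-- geometrically fast approximation in `μ` forces order convergence, so `z ∈ D`. Such `z` are order
-- dense because `I` separates points, and every positive `x` is their directed supremum, so `x ∈
-- D`.
--
-- In the `S`-additive case `max (ρ x) 0` belongs to the first class, and translation along `S`
-- carries every real level of `ρ` to level zero.

universe u

/-! ### Order convergence and suprema in Archimedean vector lattices -/

section Basic

variable {X : Type u} [AddCommGroup X] [Lattice X]

theorem ArchimedeanLattice.eq_zero_of_forall_nsmul_le (hX : ArchimedeanLattice X) {x y : X}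
    (hx : 0 ≤ x) (h : ∀ n : ℕ, n • x ≤ y) : x = 0 :=
  hX x y hx (by simpa using h 0) h

/-- The set `A` is downward directed with infimum `0`. -/
structure DecreasesToZero (A : Set X) : Prop where
  nonempty : A.Nonempty
  directed : DirectedOn (· ≥ ·) A
  isGLB : IsGLB A 0

theorem DecreasesToZero.nonneg {A : Set X} (hA : DecreasesToZero A) {a : X} (ha : a ∈ A) :
    0 ≤ a := hA.isGLB.1 ha

theorem decreasesToZero_range {κ : Type*} [Preorder κ] [IsDirectedOrder κ] [Nonempty κ] {y : κ → X}
    (hy : Antitone y) (h : IsGLB (Set.range y) 0) : DecreasesToZero (Set.range y) := by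
  refine ⟨Set.range_nonempty y, ?_, h⟩
  rintro _ ⟨i, rfl⟩ _ ⟨j, rfl⟩
  obtain ⟨k, hi, hj⟩ := exists_ge_ge i j
  exact ⟨y k, ⟨k, rfl⟩, hy hi, hy hj⟩

theorem DecreasesToZero.orderConverges {A : Set X} (hA : DecreasesToZero A) {ι : Type*}
    [Preorder ι] {x : ι → X} {a : X} (h : ∀ y ∈ A, ∃ i₀, ∀ i, i₀ ≤ i → |x i - a| ≤ y) :
    OrderConverges x a := by
  refine ⟨Aᵒᵈ, inferInstance, ⟨fun p q => ?_⟩, hA.nonempty.to_subtype,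
    fun p => (OrderDual.ofDual p : A).1, fun p q h => h, ?_, fun p => h _ (OrderDual.ofDual p).2⟩
  · obtain ⟨r, hr, h₁, h₂⟩ := hA.directed _ (OrderDual.ofDual p).2 _ (OrderDual.ofDual q).2
    exact ⟨OrderDual.toDual ⟨r, hr⟩, h₁, h₂⟩
  · convert hA.isGLB
    ext z
    exact ⟨fun ⟨p, hp⟩ => hp ▸ (OrderDual.ofDual p).2, fun hz => ⟨OrderDual.toDual ⟨z, hz⟩, rfl⟩⟩

theorem DecreasesToZero.inf_left {A : Set X} (hA : DecreasesToZero A) {x : X} (hx : 0 ≤ x) :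
    DecreasesToZero ((fun a => x ⊓ a) '' A) := by
  refine ⟨hA.nonempty.image _, ?_, ?_, ?_⟩
  · rintro _ ⟨v, hv, rfl⟩ _ ⟨w, hw, rfl⟩
    obtain ⟨z, hz, h₁, h₂⟩ := hA.directed v hv w hw
    exact ⟨x ⊓ z, ⟨z, hz, rfl⟩, inf_le_inf_left x h₁, inf_le_inf_left x h₂⟩
  · rintro _ ⟨v, hv, rfl⟩
    exact le_inf hx (hA.nonneg hv)
  · intro b hb
    exact hA.isGLB.2 fun a ha => (hb ⟨a, ha, rfl⟩).trans inf_le_right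

theorem orderConverges_iff {ι : Type*} [Preorder ι] {x : ι → X} {a : X} :
    OrderConverges x a ↔ ∃ A : Set X, DecreasesToZero A ∧
      ∀ y ∈ A, ∃ i₀, ∀ i, i₀ ≤ i → |x i - a| ≤ y := by
  constructor
  · rintro ⟨κ, _, _, _, y, hy, hg, h⟩
    exact ⟨Set.range y, decreasesToZero_range hy hg, by rintro _ ⟨b, rfl⟩; exact h b⟩
  · rintro ⟨A, hA, h⟩
    exact hA.orderConverges h

theorem OrderConverges.of_abs_sub_le {ι : Type*} [Preorder ι] {x x' : ι → X} {a a' : X}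
    (h : OrderConverges x a) (hle : ∀ i, |x' i - a'| ≤ |x i - a|) : OrderConverges x' a' := by
  obtain ⟨A, hA, h⟩ := orderConverges_iff.1 h
  exact hA.orderConverges fun y hy => (h y hy).imp fun i₀ hi i hi' => (hle i).trans (hi i hi')

variable [IsOrderedAddMonoid X]

theorem abs_sub_le_of_mem_Icc {a b x : X} (hx : x ∈ Set.Icc a b) : |x - b| ≤ b - a := by
  rw [abs_sub_comm, abs_of_nonneg (sub_nonneg.2 hx.2)]
  exact sub_le_sub_left hx.1 b

theorem sub_inf_le_abs_sub (a b : X) : a - b ⊓ a ≤ |b - a| := by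
  rw [sub_inf, sub_self, abs_sub_comm]
  exact sup_le (le_abs_self _) (abs_nonneg _)

theorem abs_negPart_sub_negPart_le (x y : X) : |x⁻ - y⁻| ≤ |x - y| := by
  have h := abs_sup_sub_sup_le_abs (-x) (-y) 0
  rwa [← negPart_def, ← negPart_def, neg_sub_neg, abs_sub_comm y x] at h

/-- Riesz decomposition: cut `w` at `a`; the remainder is `0 ⊔ (w - a)`. -/
theorem exists_add_of_le_add {a b w : X} (ha : 0 ≤ a) (hw : 0 ≤ w) (hb : 0 ≤ b)
    (h : w ≤ a + b) : ∃ w₁ w₂, 0 ≤ w₁ ∧ w₁ ≤ a ∧ 0 ≤ w₂ ∧ w₂ ≤ b ∧ w = w₁ + w₂ := by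
  refine ⟨w ⊓ a, w - w ⊓ a, le_inf hw ha, inf_le_right, sub_nonneg.2 inf_le_left, ?_, by abel⟩
  rw [sub_inf, sub_self]
  exact sup_le hb (sub_le_iff_le_add'.2 h)

/-- If the elements satisfying an additive property are order dense below `x`, then `x` is the
supremum of those among them that lie in `[0, x]`. -/
theorem ArchimedeanLattice.isLUB_of_dense (hX : ArchimedeanLattice X) {P : X → Prop} {x : X}
    (hx : 0 ≤ x) (h0 : P 0) (hadd : ∀ v w, 0 ≤ v → 0 ≤ w → P v → P w → P (v + w))
    (hdense : ∀ w, 0 ≤ w → w ≠ 0 → w ≤ x → ∃ v, 0 ≤ v ∧ v ≠ 0 ∧ v ≤ w ∧ P v) :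
    IsLUB {v | 0 ≤ v ∧ v ≤ x ∧ P v} x := by
  refine ⟨fun v hv => hv.2.1, fun b hb => ?_⟩
  by_contra hxb
  have hw0 : x - b ⊓ x ≠ 0 := fun h => hxb (by
    rw [sub_eq_zero] at h; exact h.le.trans inf_le_left)
  have hb0 : 0 ≤ b ⊓ x := le_inf (hb ⟨le_rfl, hx, h0⟩) hx
  obtain ⟨v, hv0, hvne, hvw, hPv⟩ :=
    hdense _ (sub_nonneg.2 inf_le_right) hw0 (sub_le_self _ hb0)
  refine hvne (hX.eq_zero_of_forall_nsmul_le (y := x) hv0 fun n => ?_)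
  suffices h : n • v ≤ x ∧ P (n • v) from h.1
  -- Each multiple `n • v` has `P` and lies in `[0, x]`, so it is below `b`; the gap `x - b ⊓ x`
  -- leaves room for one more `v`.
  induction n with
  | zero => simpa using ⟨hx, h0⟩
  | succ n ih =>
    have hn : 0 ≤ n • v := nsmul_nonneg hv0 n
    rw [succ_nsmul]
    refine ⟨?_, hadd _ _ hn hv0 ih.2 hPv⟩
    calc n • v + v ≤ b ⊓ x + (x - b ⊓ x) :=
          add_le_add (le_inf (hb ⟨hn, ih.1, ih.2⟩) ih.1) hvw
      _ = x := by abel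

theorem OrderConverges.uoConverges {ι : Type*} [Preorder ι] {x : ι → X} {a : X}
    (h : OrderConverges x a) : UOConverges x a := fun y hy => h.of_abs_sub_le fun i => by
  rw [sub_zero, abs_of_nonneg (le_inf (abs_nonneg _) hy)]
  exact inf_le_left

theorem UOConverges.of_abs_sub_le {ι : Type*} [Preorder ι] {x x' : ι → X} {a a' : X}
    (h : UOConverges x a) (hle : ∀ i, |x' i - a'| ≤ |x i - a|) : UOConverges x' a' :=
  fun y hy => (h y hy).of_abs_sub_le fun i => by
    rw [sub_zero, sub_zero, abs_of_nonneg (le_inf (abs_nonneg _) hy),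
      abs_of_nonneg (le_inf (abs_nonneg _) hy)]
    exact inf_le_inf_right _ (hle i)

theorem DecreasesToZero.of_isLUB {V : Set X} (hne : V.Nonempty) (hd : DirectedOn (· ≤ ·) V) {a : X}
    (h : IsLUB V a) : DecreasesToZero ((fun v => a - v) '' V) := by
  refine ⟨hne.image _, ?_, ?_, ?_⟩
  · rintro _ ⟨v, hv, rfl⟩ _ ⟨w, hw, rfl⟩
    obtain ⟨z, hz, h₁, h₂⟩ := hd v hv w hw
    exact ⟨a - z, ⟨z, hz, rfl⟩, sub_le_sub_left h₁ a, sub_le_sub_left h₂ a⟩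
  · rintro _ ⟨v, hv, rfl⟩
    exact sub_nonneg.2 (h.1 hv)
  · intro b hb
    have : a ≤ a - b := h.2 fun v hv => le_sub_comm.1 (hb ⟨v, hv, rfl⟩)
    simpa using this

/-- The elements of an upward directed set converge in order to its supremum. -/
theorem orderConverges_of_isLUB {V : Set X} (hne : V.Nonempty) (hd : DirectedOn (· ≤ ·) V) {a : X}
    (h : IsLUB V a) : OrderConverges (fun v : V => v.1) a := by
  refine (DecreasesToZero.of_isLUB hne hd h).orderConverges ?_
  rintro _ ⟨v, hv, rfl⟩
  exact ⟨⟨v, hv⟩, fun w hw => abs_sub_le_of_mem_Icc ⟨hw, h.1 w.2⟩⟩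

omit [IsOrderedAddMonoid X] in
theorem OrderConverges.neg {ι : Type*} [Preorder ι] {x : ι → X} {a : X}
    (h : OrderConverges x a) : OrderConverges (fun i => -x i) (-a) :=
  h.of_abs_sub_le fun i => by rw [neg_sub_neg, abs_sub_comm]

/-- The differences between the upper bounds and the elements of an upward directed bounded set
decrease to `0`. -/
theorem ArchimedeanLattice.decreasesToZero_upperBounds_sub (hX : ArchimedeanLattice X) {V : Set X}
    (hne : V.Nonempty) (hd : DirectedOn (· ≤ ·) V) (hb : BddAbove V) :
    DecreasesToZero (Set.image2 (fun u v => u - v) (upperBounds V) V) := by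
  refine ⟨Set.Nonempty.image2 hb hne, ?_, ?_, ?_⟩
  · rintro _ ⟨u, hu, v, hv, rfl⟩ _ ⟨u', hu', v', hv', rfl⟩
    obtain ⟨w, hw, h₁, h₂⟩ := hd v hv v' hv'
    exact ⟨_, ⟨u ⊓ u', fun z hz => le_inf (hu hz) (hu' hz), w, hw, rfl⟩,
      sub_le_sub inf_le_left h₁, sub_le_sub inf_le_right h₂⟩
  · rintro _ ⟨u, hu, v, hv, rfl⟩
    exact sub_nonneg.2 (hu hv)
  · intro b hb'
    obtain ⟨u, hu⟩ := hb
    obtain ⟨v, hv⟩ := hne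
    -- A lower bound `b` of all differences lets any upper bound be lowered by `b⁺`, again and
    -- again.
    have key : ∀ n : ℕ, u - n • b⁺ ∈ upperBounds V := by
      intro n
      induction n with
      | zero => simpa using hu
      | succ n ih =>
        intro w hw
        have h1 : b⁺ ≤ u - n • b⁺ - w :=
          sup_le (hb' ⟨_, ih, w, hw, rfl⟩) (sub_nonneg.2 (ih hw))
        rw [succ_nsmul, ← sub_sub]
        exact le_sub_comm.1 h1
    have := hX.eq_zero_of_forall_nsmul_le (y := u - v) (posPart_nonneg b)
      fun n => le_sub_comm.1 (key n hv)
    exact posPart_eq_zero.1 this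

theorem partialSups_le_sum_range {y : ℕ → X} (hy : ∀ n, 0 ≤ y n) (n : ℕ) :
    partialSups y n ≤ ∑ k ∈ Finset.range (n + 1), y k :=
  partialSups_le _ _ _ fun _ hk => Finset.single_le_sum (f := y) (fun i _ => hy i)
    (Finset.mem_range.2 (Nat.lt_succ_of_le hk))

theorem directedOn_le_of_add {P : X → Prop} {x : X}
    (hadd : ∀ v w, 0 ≤ v → 0 ≤ w → P v → P w → P (v + w))
    (hmono : ∀ v w, 0 ≤ v → v ≤ w → P w → P v) :
    DirectedOn (· ≤ ·) {v | 0 ≤ v ∧ v ≤ x ∧ P v} := by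
  rintro v ⟨hv0, hvx, hv⟩ w ⟨hw0, hwx, hw⟩
  have h0 : 0 ≤ v ⊔ w := hv0.trans le_sup_left
  exact ⟨v ⊔ w, ⟨h0, sup_le hvx hwx, hmono _ _ h0 (sup_le (le_add_of_nonneg_right hw0)
    (le_add_of_nonneg_left hv0)) (hadd v w hv0 hw0 hv hw)⟩, le_sup_left, le_sup_right⟩

end Basic

/-! ### Order continuous functionals, their moduli, and ideals -/

section Functionals

variable {X : Type u} [AddCommGroup X] [Module ℝ X] [Lattice X] [IsOrderedAddMonoid X]

theorem OrderContinuousFunctional.exists_abs_lt {φ : X →ₗ[ℝ] ℝ}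
    (hφ : OrderContinuousFunctional φ) {A : Set X} (hA : DecreasesToZero A) {ε : ℝ} (hε : 0 < ε) :
    ∃ a ∈ A, ∀ b ∈ A, b ≤ a → |φ b| < ε := by
  have : Nonempty Aᵒᵈ := hA.nonempty.to_subtype
  have : IsDirectedOrder Aᵒᵈ := ⟨fun p q => by
    obtain ⟨r, hr, h₁, h₂⟩ := hA.directed _ (OrderDual.ofDual p).2 _ (OrderDual.ofDual q).2
    exact ⟨OrderDual.toDual ⟨r, hr⟩, h₁, h₂⟩⟩
  have h := hφ Aᵒᵈ (fun p => (OrderDual.ofDual p : A).1) 0 <| hA.orderConverges fun y hy =>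
    ⟨OrderDual.toDual ⟨y, hy⟩, fun i hi => by
      rw [sub_zero, abs_of_nonneg (hA.nonneg (OrderDual.ofDual i).2)]; exact hi⟩
  rw [map_zero] at h
  obtain ⟨p, hp⟩ := eventually_atTop.1 (Metric.tendsto_nhds.1 h ε hε)
  exact ⟨_, (OrderDual.ofDual p).2, fun b hb hba => by
    simpa using hp (OrderDual.toDual ⟨b, hb⟩) hba⟩

theorem map_mono_of_nonneg {μ : X →ₗ[ℝ] ℝ} (hμ : ∀ x, 0 ≤ x → 0 ≤ μ x) {x y : X} (h : x ≤ y) :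
    μ x ≤ μ y := by
  have := hμ _ (sub_nonneg.2 h)
  rwa [map_sub, sub_nonneg] at this

theorem orderContinuousFunctional_of_abs_le {f μ : X →ₗ[ℝ] ℝ} (hμ0 : ∀ x, 0 ≤ x → 0 ≤ μ x)
    (hμ : ∀ A, DecreasesToZero A → ∀ ε > 0, ∃ a ∈ A, μ a < ε) (hf : ∀ x, |f x| ≤ μ |x|) :
    OrderContinuousFunctional f := by
  intro ι _ _ _ x a h
  obtain ⟨A, hA, h⟩ := orderConverges_iff.1 h
  rw [Metric.tendsto_nhds]
  intro ε hε
  obtain ⟨y, hy, hyε⟩ := hμ A hA ε hε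
  obtain ⟨i₀, hi₀⟩ := h y hy
  filter_upwards [eventually_ge_atTop i₀] with i hi
  rw [Real.dist_eq, ← map_sub]
  exact ((hf _).trans (map_mono_of_nonneg hμ0 (hi₀ i hi))).trans_lt hyε

theorem OrderContinuousFunctional.of_abs_le {f μ : X →ₗ[ℝ] ℝ} (hμ0 : ∀ x, 0 ≤ x → 0 ≤ μ x)
    (hμ : OrderContinuousFunctional μ) (hf : ∀ x, |f x| ≤ μ |x|) :
    OrderContinuousFunctional f :=
  orderContinuousFunctional_of_abs_le hμ0 (fun A hA ε hε => by
    obtain ⟨a, ha, h⟩ := hμ.exists_abs_lt hA hε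
    exact ⟨a, ha, (le_abs_self _).trans_lt (h a ha le_rfl)⟩) hf

theorem abs_map_le_map_abs {f μ : X →ₗ[ℝ] ℝ} (h : ∀ x, 0 ≤ x → |f x| ≤ μ x) (x : X) :
    |f x| ≤ μ |x| := by
  rw [← posPart_add_negPart x, map_add]
  nth_rw 1 [← posPart_sub_negPart x]
  rw [map_sub]
  exact (abs_sub _ _).trans (add_le_add (h _ (posPart_nonneg x)) (h _ (negPart_nonneg x)))

/-- An additive, positively homogeneous function on the positive cone extends linearly. -/
theorem exists_linearMap_eq_of_nonneg [IsOrderedModule ℝ X] (p : X → ℝ)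
    (hadd : ∀ x y, 0 ≤ x → 0 ≤ y → p (x + y) = p x + p y)
    (hsmul : ∀ (c : ℝ) x, 0 ≤ c → 0 ≤ x → p (c • x) = c * p x) :
    ∃ f : X →ₗ[ℝ] ℝ, ∀ x, 0 ≤ x → f x = p x := by
  -- The value does not depend on the chosen difference of positive elements, so any convenient
  -- decomposition may replace the one into positive and negative parts.
  have key : ∀ a b c d : X, 0 ≤ a → 0 ≤ b → 0 ≤ c → 0 ≤ d → a - b = c - d →
      p a - p b = p c - p d := by
    intro a b c d ha hb hc hd h
    have h1 : a + d = c + b := by rw [sub_eq_sub_iff_add_eq_add] at h; exact h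
    have h2 := hadd a d ha hd
    rw [h1, hadd c b hc hb] at h2
    linarith
  have hp := fun x : X => posPart_nonneg x
  have hn := fun x : X => negPart_nonneg x
  refine ⟨
    { toFun := fun x => p x⁺ - p x⁻
      map_add' := fun x y => ?_
      map_smul' := fun c x => ?_ }, fun x hx => ?_⟩
  · rw [key _ _ (x⁺ + y⁺) (x⁻ + y⁻) (hp _) (hn _) (add_nonneg (hp x) (hp y))
      (add_nonneg (hn x) (hn y)), hadd _ _ (hp x) (hp y), hadd _ _ (hn x) (hn y)]
    · ring
    · rw [posPart_sub_negPart, add_sub_add_comm, posPart_sub_negPart, posPart_sub_negPart]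
  · simp only [RingHom.id_apply, smul_eq_mul]
    rcases le_total 0 c with hc | hc
    · rw [key _ _ (c • x⁺) (c • x⁻) (hp _) (hn _) (smul_nonneg hc (hp x))
        (smul_nonneg hc (hn x)), hsmul _ _ hc (hp x), hsmul _ _ hc (hn x)]
      · ring
      · rw [posPart_sub_negPart, ← smul_sub, posPart_sub_negPart]
    · have hc' : 0 ≤ -c := neg_nonneg.2 hc
      rw [key _ _ ((-c) • x⁻) ((-c) • x⁺) (hp _) (hn _) (smul_nonneg hc' (hn x))
        (smul_nonneg hc' (hp x)), hsmul _ _ hc' (hp x), hsmul _ _ hc' (hn x)]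
      · ring
      · rw [posPart_sub_negPart, ← smul_sub, neg_smul, ← smul_neg, neg_sub, posPart_sub_negPart]
  · have h0 : p 0 = 0 := by simpa using hsmul 0 0 le_rfl le_rfl
    simp [posPart_of_nonneg hx, negPart_of_nonneg hx, h0]

theorem IsModulus.nonneg {φ μ : orderContinuousDual X} (h : IsModulus φ μ) : 0 ≤ μ := by
  intro x hx
  have h1 := h.1 (Set.mem_insert _ _) x hx
  have h2 := h.1 (Set.mem_insert_of_mem _ rfl) x hx
  change -(φ.1 x) ≤ _ at h2
  change 0 ≤ μ.1 x
  linarith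

theorem isModulus_self {μ : orderContinuousDual X} (h : 0 ≤ μ) : IsModulus μ μ := by
  refine ⟨?_, fun ν hν => hν (Set.mem_insert _ _)⟩
  rintro ψ (rfl | rfl)
  · exact le_rfl
  · intro x hx
    have : (0 : ℝ) ≤ μ.1 x := h x hx
    change -(μ.1 x) ≤ _
    linarith

theorem IsDualIdeal.modulus_mem {I : Submodule ℝ (orderContinuousDual X)} (hI : IsDualIdeal I)
    {φ μ : orderContinuousDual X} (h : IsModulus φ μ) (hφ : φ ∈ I) : μ ∈ I :=
  hI φ μ μ μ h (isModulus_self h.nonneg) hφ le_rfl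

variable [IsOrderedModule ℝ X]

theorem abs_smul_of_nonneg {c : ℝ} (hc : 0 ≤ c) (x : X) : |c • x| = c • |x| := by
  have h : ∀ (d : ℝ), 0 ≤ d → ∀ y : X, |d • y| ≤ d • |y| := fun d hd y =>
    sup_le (smul_le_smul_of_nonneg_left (le_abs_self y) hd) (by
      rw [← smul_neg]; exact smul_le_smul_of_nonneg_left (neg_le_abs y) hd)
  refine le_antisymm (h c hc x) ?_
  rcases hc.eq_or_lt with rfl | hc'
  · simp
  · have := smul_le_smul_of_nonneg_left (h c⁻¹ (inv_nonneg.2 hc) (c • x)) hc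
    rwa [smul_smul, inv_mul_cancel₀ hc'.ne', one_smul, smul_smul, mul_inv_cancel₀ hc'.ne',
      one_smul] at this

theorem ArchimedeanLattice.decreasesToZero_range_smul (hX : ArchimedeanLattice X) {x : X}
    (hx : 0 ≤ x) : DecreasesToZero (Set.range fun n : ℕ => ((n : ℝ) + 1)⁻¹ • x) := by
  apply decreasesToZero_range
  · intro m n h
    refine smul_le_smul_of_nonneg_right ?_ hx
    have : (m : ℝ) ≤ n := by exact_mod_cast h
    gcongr
  · refine ⟨?_, fun b hb => ?_⟩
    · rintro _ ⟨n, rfl⟩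
      exact smul_nonneg (by positivity) hx
    · rw [← posPart_eq_zero]
      refine hX.eq_zero_of_forall_nsmul_le (y := x) (posPart_nonneg b) fun n => ?_
      have h1 : b⁺ ≤ ((n : ℝ) + 1)⁻¹ • x :=
        sup_le (hb ⟨n, rfl⟩) (smul_nonneg (by positivity) hx)
      have h2 := smul_le_smul_of_nonneg_left h1 (by positivity : (0 : ℝ) ≤ (n : ℝ) + 1)
      rw [smul_smul, mul_inv_cancel₀ (by positivity), one_smul, add_smul, one_smul,
        Nat.cast_smul_eq_nsmul] at h2
      exact (le_add_of_nonneg_right (posPart_nonneg b)).trans h2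

/-- If `φ (y n) > n + 1` with `y n ∈ [0, x]`, then `y n / (n + 1)` is dominated by `x / (n + 1)` and
tends to `0` in order, while `φ` stays above `1` on it. -/
theorem OrderContinuousFunctional.bddAbove_image_Icc (hX : ArchimedeanLattice X) {φ : X →ₗ[ℝ] ℝ}
    (hφ : OrderContinuousFunctional φ) {x : X} (hx : 0 ≤ x) : BddAbove (φ '' Set.Icc 0 x) := by
  by_contra hb
  rw [not_bddAbove_iff] at hb
  have : ∀ n : ℕ, ∃ y ∈ Set.Icc 0 x, (n : ℝ) + 1 < φ y := fun n => by
    obtain ⟨_, ⟨y, hy, rfl⟩, h⟩ := hb (n + 1)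
    exact ⟨y, hy, h⟩
  choose y hy hlt using this
  have hc : OrderConverges (fun n : ULift.{u} ℕ => ((n.down : ℝ) + 1)⁻¹ • y n.down) 0 := by
    refine (hX.decreasesToZero_range_smul hx).orderConverges ?_
    rintro _ ⟨n, rfl⟩
    refine ⟨⟨n⟩, fun m hm => ?_⟩
    have hm' : (n : ℝ) ≤ m.down := by exact_mod_cast ULift.down_le.2 hm
    rw [sub_zero, abs_of_nonneg (smul_nonneg (by positivity) (hy _).1)]
    exact (smul_le_smul_of_nonneg_left (hy _).2 (by positivity)).trans
      (smul_le_smul_of_nonneg_right (by gcongr) hx)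
  have h := hφ _ _ _ hc
  rw [map_zero] at h
  obtain ⟨n, hn⟩ := eventually_atTop.1 (h.eventually_lt_const one_pos)
  have h1 := hn n le_rfl
  rw [map_smul, smul_eq_mul, inv_mul_lt_iff₀ (by positivity)] at h1
  linarith [hlt n.down]

/-- The Riesz–Kantorovich formula for the positive part of an order continuous functional. -/
theorem OrderContinuousFunctional.exists_posPart (hX : ArchimedeanLattice X) {φ : X →ₗ[ℝ] ℝ}
    (hφ : OrderContinuousFunctional φ) :
    ∃ p : X →ₗ[ℝ] ℝ, OrderContinuousFunctional p ∧
      ∀ x, 0 ≤ x → IsLUB (φ '' Set.Icc 0 x) (p x) := by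
  have hne : ∀ x : X, 0 ≤ x → (φ '' Set.Icc 0 x).Nonempty :=
    fun x hx => ⟨_, 0, ⟨le_rfl, hx⟩, rfl⟩
  have hlub : ∀ x : X, 0 ≤ x → IsLUB (φ '' Set.Icc 0 x) (sSup (φ '' Set.Icc 0 x)) :=
    fun x hx => isLUB_csSup (hne x hx) (hφ.bddAbove_image_Icc hX hx)
  obtain ⟨p, hp⟩ := exists_linearMap_eq_of_nonneg (fun x => sSup (φ '' Set.Icc 0 x))
    (fun x y hx hy => by
      refine (hlub _ (add_nonneg hx hy)).unique ⟨?_, fun b hb => ?_⟩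
      · rintro _ ⟨w, hw, rfl⟩
        obtain ⟨w₁, w₂, h1, h2, h3, h4, rfl⟩ := exists_add_of_le_add hx hw.1 hy hw.2
        rw [map_add]
        exact add_le_add ((hlub x hx).1 ⟨w₁, ⟨h1, h2⟩, rfl⟩) ((hlub y hy).1 ⟨w₂, ⟨h3, h4⟩, rfl⟩)
      · rw [← le_sub_iff_add_le]
        refine (hlub x hx).2 ?_
        rintro _ ⟨v, hv, rfl⟩
        rw [le_sub_comm]
        refine (hlub y hy).2 ?_
        rintro _ ⟨w, hw, rfl⟩
        rw [le_sub_iff_add_le', ← map_add]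
        exact hb ⟨v + w, ⟨add_nonneg hv.1 hw.1, add_le_add hv.2 hw.2⟩, rfl⟩)
    (fun c x hc hx => by
      rcases hc.eq_or_lt with rfl | hc'
      · simp
      refine (hlub _ (smul_nonneg hc hx)).unique ⟨?_, fun b hb => ?_⟩
      · rintro _ ⟨w, hw, rfl⟩
        rw [← inv_mul_le_iff₀ hc', ← smul_eq_mul, ← map_smul]
        refine (hlub x hx).1 ⟨_, ⟨smul_nonneg (by positivity) hw.1, ?_⟩, rfl⟩
        have := smul_le_smul_of_nonneg_left hw.2 (inv_nonneg.2 hc)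
        rwa [smul_smul, inv_mul_cancel₀ hc'.ne', one_smul] at this
      · rw [← le_inv_mul_iff₀ hc']
        refine (hlub x hx).2 ?_
        rintro _ ⟨v, hv, rfl⟩
        rw [le_inv_mul_iff₀ hc', ← smul_eq_mul, ← map_smul]
        exact hb ⟨_, ⟨smul_nonneg hc hv.1, smul_le_smul_of_nonneg_left hv.2 hc⟩, rfl⟩)
  have hpl : ∀ x, 0 ≤ x → IsLUB (φ '' Set.Icc 0 x) (p x) := fun x hx => hp x hx ▸ hlub x hx
  have hp0 : ∀ x, 0 ≤ x → 0 ≤ p x := fun x hx => (hpl x hx).1 ⟨0, ⟨le_rfl, hx⟩, map_zero _⟩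
  refine ⟨p, orderContinuousFunctional_of_abs_le hp0 (fun A hA ε hε => ?_)
    (abs_map_le_map_abs fun x hx => (abs_of_nonneg (hp0 x hx)).le), hpl⟩
  obtain ⟨x, hx⟩ := hA.nonempty
  have hx0 := hA.nonneg hx
  -- A near-maximizer `y` on `[0, x]` controls `p b` for small `b ∈ A`: `p x - p b ≥ φ y - φ (y ⊓ b)
  -- > p x - ε`, each of the two terms costing `ε / 2`.
  obtain ⟨_, ⟨y, hy, rfl⟩, hylt, -⟩ := (hpl x hx0).exists_between (show p x - ε / 2 < p x by linarith)
  obtain ⟨_, ⟨a, ha, rfl⟩, h⟩ := hφ.exists_abs_lt (hA.inf_left hy.1) (half_pos hε)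
  obtain ⟨b, hb, hba, hbx⟩ := hA.directed a ha x hx
  refine ⟨b, hb, ?_⟩
  have h1 := h _ ⟨b, hb, rfl⟩ (inf_le_inf_left y hba)
  have h2 : φ (y - y ⊓ b) ≤ p (x - b) := by
    refine (hpl _ (sub_nonneg.2 hbx)).1 ⟨_, ⟨sub_nonneg.2 inf_le_left, ?_⟩, rfl⟩
    rw [sub_inf, sub_self]
    exact sup_le (sub_nonneg.2 hbx) (sub_le_sub_right hy.2 b)
  rw [map_sub, map_sub] at h2
  dsimp only at h1
  linarith [le_abs_self (φ (y ⊓ b))]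

/-- The modulus is `2 φ⁺ - φ`. It is least because an upper bound `ν` of `φ` and `-φ` satisfies `φ w
- φ (x - w) ≤ ν x` for all `w ∈ [0, x]`. -/
theorem exists_isModulus (hX : ArchimedeanLattice X) (φ : orderContinuousDual X) :
    ∃ μ, IsModulus φ μ := by
  obtain ⟨p, hp, hpl⟩ := OrderContinuousFunctional.exists_posPart hX φ.2
  have hle : ∀ x, 0 ≤ x → φ.1 x ≤ p x := fun x hx => (hpl x hx).1 ⟨x, ⟨hx, le_rfl⟩, rfl⟩
  have hp0 : ∀ x, 0 ≤ x → 0 ≤ p x := fun x hx => (hpl x hx).1 ⟨0, ⟨le_rfl, hx⟩, map_zero _⟩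
  have happ : ∀ x, ((2 : ℝ) • (⟨p, hp⟩ : orderContinuousDual X) - φ).1 x = 2 * p x - φ.1 x :=
    fun x => rfl
  refine ⟨(2 : ℝ) • ⟨p, hp⟩ - φ, ?_, fun ν hν x hx => ?_⟩
  · rintro ψ (rfl | rfl) x hx
    · rw [happ]
      linarith [hle x hx]
    · rw [happ]
      show - φ.1 x ≤ _
      linarith [hp0 x hx]
  · rw [happ]
    have h : p x ≤ (ν.1 x + φ.1 x) / 2 := by
      refine (hpl x hx).2 ?_
      rintro _ ⟨w, hw, rfl⟩
      have h1 := hν (Set.mem_insert _ _) w hw.1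
      have h2 := hν (Set.mem_insert _ _) (x - w) (sub_nonneg.2 hw.2)
      have h3 := hν (Set.mem_insert_of_mem _ rfl) (x - w) (sub_nonneg.2 hw.2)
      change -(φ.1 (x - w)) ≤ _ at h3
      simp only [map_sub] at h2 h3
      linarith
    linarith

theorem IsDualIdeal.mem_of_abs_le (hX : ArchimedeanLattice X)
    {I : Submodule ℝ (orderContinuousDual X)} (hI : IsDualIdeal I) {f μ : orderContinuousDual X}
    (hμ : μ ∈ I) (h0 : 0 ≤ μ) (hf : ∀ x, 0 ≤ x → |f.1 x| ≤ μ.1 x) : f ∈ I := by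
  obtain ⟨ν, hν⟩ := exists_isModulus hX f
  refine hI μ f μ ν (isModulus_self h0) hν hμ (hν.2 ?_)
  rintro ψ (rfl | rfl) x hx
  · exact (le_abs_self _).trans (hf x hx)
  · exact (neg_le_abs _).trans (hf x hx)

theorem IsDualIdeal.exists_pos (hX : ArchimedeanLattice X)
    {I : Submodule ℝ (orderContinuousDual X)} (hI : IsDualIdeal I) (hs : SeparatesPoints I)
    {w : X} (hw : 0 ≤ w) (hne : w ≠ 0) : ∃ μ ∈ I, 0 ≤ μ ∧ 0 < μ.1 w := by
  obtain ⟨φ, hφ, h⟩ := hs w 0 hne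
  rw [map_zero] at h
  obtain ⟨μ, hμ⟩ := exists_isModulus hX φ
  refine ⟨μ, hI.modulus_mem hμ hφ, hμ.nonneg, ?_⟩
  have h1 := hμ.1 (Set.mem_insert _ _) w hw
  have h2 := hμ.1 (Set.mem_insert_of_mem _ rfl) w hw
  change -(φ.1 w) ≤ _ at h2
  rcases lt_or_gt_of_ne h with h | h <;> linarith

end Functionals

/-! ### From seminorm approximation to order convergence -/

section Closedness

variable {X : Type u} [AddCommGroup X] [Module ℝ X] [Lattice X] [IsOrderedAddMonoid X]

/-- `φ` does not vanish on `[0, z]` except at `0`. -/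
def StrictlyPositiveBelow (φ : X →ₗ[ℝ] ℝ) (z : X) : Prop :=
  ∀ w, 0 ≤ w → w ≤ z → φ w = 0 → w = 0

/-- A Borel–Cantelli argument: summability of `φ (z - y n)` makes `φ` vanish on `b⁺` for every `b`
below all eventual upper bounds of `z - y n`, and strict positivity then gives `b⁺ = 0`. -/
theorem orderConverges_of_strictlyPositiveBelow (hX : ArchimedeanLattice X) {φ : X →ₗ[ℝ] ℝ}
    (hφ : OrderContinuousFunctional φ) (hφ0 : ∀ x, 0 ≤ x → 0 ≤ φ x) {z : X}
    (hz : StrictlyPositiveBelow φ z) {y : ℕ → X} (hy : ∀ n, y n ∈ Set.Icc 0 z)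
    (hlt : ∀ n, φ (z - y n) ≤ (1 / 2) ^ n) :
    OrderConverges (fun n : ULift.{u} ℕ => y n.down) z := by
  have hy0 : ∀ n, 0 ≤ z - y n := fun n => sub_nonneg.2 (hy n).2
  have hyz : ∀ n, z - y n ≤ z := fun n => sub_le_self z (hy n).1
  have hA : DecreasesToZero {u : X | ∃ n, ∀ k, n ≤ k → z - y k ≤ u} := by
    refine ⟨⟨z, 0, fun k _ => hyz k⟩, ?_, ?_, fun b hb => ?_⟩
    · rintro u ⟨n, hn⟩ v ⟨m, hm⟩
      exact ⟨u ⊓ v, ⟨max n m, fun k hk => le_inf (hn k ((le_max_left _ _).trans hk))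
        (hm k ((le_max_right _ _).trans hk))⟩, inf_le_left, inf_le_right⟩
    · rintro u ⟨n, hn⟩
      exact (hy0 n).trans (hn n le_rfl)
    rw [← posPart_eq_zero]
    have hbz : b⁺ ≤ z := sup_le (hb ⟨0, fun k _ => hyz k⟩) ((hy0 0).trans (hyz 0))
    refine hz _ (posPart_nonneg b) hbz (le_antisymm ?_ (hφ0 _ (posPart_nonneg b)))
    have key : ∀ n : ℕ, φ b⁺ ≤ 3 * (1 / 2) ^ n := by
      intro n
      -- The tail may have no supremum. Instead, some upper bound `u` of the finite suprema is
      -- within `(1 / 2) ^ n` of one of them under `φ`; the geometric sum contributes the other `2 *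
      -- (1 / 2) ^ n`.
      set s := partialSups fun k => z - y (n + k) with hs
      have hbdd : BddAbove (Set.range s) := ⟨z, by
        rintro _ ⟨m, rfl⟩
        exact partialSups_le _ _ _ fun k _ => hyz _⟩
      obtain ⟨_, ⟨u, hu, _, ⟨m, rfl⟩, rfl⟩, h⟩ := hφ.exists_abs_lt
        (hX.decreasesToZero_upperBounds_sub (Set.range_nonempty s)
          (directedOn_range.2 s.monotone.directed_le) hbdd)
        (show (0 : ℝ) < (1 / 2) ^ n by positivity)
      have h1 := h _ ⟨u, hu, _, ⟨m, rfl⟩, rfl⟩ le_rfl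
      dsimp only at h1
      rw [map_sub] at h1
      have h2 : φ b⁺ ≤ φ u := map_mono_of_nonneg hφ0 <| by
        have hu' : ∀ k, n ≤ k → z - y k ≤ u := fun k hk => by
          obtain ⟨j, rfl⟩ := Nat.exists_eq_add_of_le hk
          exact (le_partialSups (fun k => z - y (n + k)) j).trans (hu ⟨j, rfl⟩)
        exact sup_le (hb ⟨n, hu'⟩) ((hy0 n).trans (hu' n le_rfl))
      have h3 : φ (s m) ≤ 2 * (1 / 2) ^ n := by
        refine (map_mono_of_nonneg hφ0 (partialSups_le_sum_range (fun k => hy0 (n + k)) m)).trans ?_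
        rw [map_sum]
        calc ∑ k ∈ Finset.range (m + 1), φ (z - y (n + k))
            ≤ ∑ k ∈ Finset.range (m + 1), (1 / 2 : ℝ) ^ n * (1 / 2) ^ k :=
              Finset.sum_le_sum fun k _ => (hlt _).trans (pow_add _ _ _).le
          _ = (1 / 2 : ℝ) ^ n * ∑ k ∈ Finset.range (m + 1), (1 / 2 : ℝ) ^ k := by
              rw [Finset.mul_sum]
          _ ≤ (1 / 2 : ℝ) ^ n * 2 :=
              mul_le_mul_of_nonneg_left (sum_geometric_two_le _) (by positivity)
          _ = _ := mul_comm _ _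
      linarith [le_abs_self (φ u - φ (s m))]
    have ht : Tendsto (fun n : ℕ => 3 * (1 / 2 : ℝ) ^ n) atTop (𝓝 (3 * 0)) :=
      (tendsto_pow_atTop_nhds_zero_of_lt_one (by norm_num) (by norm_num)).const_mul 3
    rw [mul_zero] at ht
    exact ge_of_tendsto' ht key
  refine hA.orderConverges ?_
  rintro u ⟨n, hn⟩
  exact ⟨⟨n⟩, fun k hk => (abs_sub_le_of_mem_Icc ⟨le_rfl, (hy _).2⟩).trans (hn _ hk)⟩

/-- Otherwise the null elements of `φ` are order dense below `w`, so `w` is their directed supremum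
and order continuity forces `φ w = 0`. -/
theorem exists_strictlyPositiveBelow (hX : ArchimedeanLattice X) {φ : X →ₗ[ℝ] ℝ}
    (hφ : OrderContinuousFunctional φ) (hφ0 : ∀ x, 0 ≤ x → 0 ≤ φ x) {w : X} (hw : 0 ≤ w)
    (hpos : 0 < φ w) : ∃ z, 0 ≤ z ∧ z ≠ 0 ∧ z ≤ w ∧ StrictlyPositiveBelow φ z := by
  by_contra hcon
  have hadd : ∀ v w, 0 ≤ v → 0 ≤ w → φ v = 0 → φ w = 0 → φ (v + w) = 0 := by
    intro v w _ _ h1 h2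
    rw [map_add, h1, h2, add_zero]
  have hmono : ∀ v w, 0 ≤ v → v ≤ w → φ w = 0 → φ v = 0 := fun v w hv hvw h =>
    le_antisymm (h ▸ map_mono_of_nonneg hφ0 hvw) (hφ0 v hv)
  have hlub := hX.isLUB_of_dense (P := fun v => φ v = 0) hw (map_zero φ) hadd
    fun v hv hvne hvw => by
      by_contra h
      exact hcon ⟨v, hv, hvne, hvw, fun u hu huv hφu => by
        by_contra hu0
        exact h ⟨u, hu, hu0, huv, hφu⟩⟩
  have hne : {v | 0 ≤ v ∧ v ≤ w ∧ φ v = 0}.Nonempty := ⟨0, le_rfl, hw, map_zero φ⟩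
  obtain ⟨_, ⟨v, hv, rfl⟩, h⟩ := hφ.exists_abs_lt
    (DecreasesToZero.of_isLUB hne (directedOn_le_of_add hadd hmono) hlub) hpos
  have := h _ ⟨v, hv, rfl⟩ le_rfl
  dsimp only at this
  rw [map_sub, hv.2.2, sub_zero] at this
  exact (le_abs_self _).not_gt this

/-- An order closed, solid subset `D` of the positive cone is closed for the seminorms `μ |x|`,
where `μ` ranges over the positive elements of a separating ideal. -/
theorem mem_of_forall_exists_lt [IsOrderedModule ℝ X] (hX : ArchimedeanLattice X)
    {I : Submodule ℝ (orderContinuousDual X)} (hI : IsDualIdeal I) (hs : SeparatesPoints I)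
    {D : Set X} (hsolid : ∀ x y, 0 ≤ y → y ≤ x → x ∈ D → y ∈ D)
    (hclosed : ∀ (ι : Type u) [Preorder ι] [IsDirectedOrder ι] [Nonempty ι] (x : ι → X) (a : X),
      OrderConverges x a → (∀ i, x i ∈ D) → a ∈ D)
    {x : X} (hx : 0 ≤ x)
    (happrox : ∀ μ ∈ I, 0 ≤ μ → ∀ ε > 0, ∃ y ∈ D, 0 ≤ y ∧ y ≤ x ∧ μ.1 (x - y) < ε) : x ∈ D := by
  let P : X → Prop := fun v => ∃ μ ∈ I, 0 ≤ μ ∧ StrictlyPositiveBelow μ.1 v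
  have hP0 : P 0 := ⟨0, I.zero_mem, le_rfl, fun w h1 h2 _ => le_antisymm h2 h1⟩
  have hmono : ∀ v w, 0 ≤ v → v ≤ w → P w → P v := by
    rintro v w - hvw ⟨μ, hμ, h0, h⟩
    exact ⟨μ, hμ, h0, fun u hu huv => h u hu (huv.trans hvw)⟩
  have hadd : ∀ v w, 0 ≤ v → 0 ≤ w → P v → P w → P (v + w) := by
    rintro v w hv hw ⟨μ, hμ, hμ0, hμv⟩ ⟨ν, hν, hν0, hνw⟩
    have happ : ∀ a, (μ + ν).1 a = μ.1 a + ν.1 a := fun a => rfl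
    have hμ0' : ∀ a, 0 ≤ a → 0 ≤ μ.1 a := hμ0
    have hν0' : ∀ a, 0 ≤ a → 0 ≤ ν.1 a := hν0
    refine ⟨μ + ν, I.add_mem hμ hν, fun a ha => ?_, fun u hu huvw hzero => ?_⟩
    · exact (add_nonneg (hμ0' a ha) (hν0' a ha)).trans_eq (happ a).symm
    · obtain ⟨a, b, ha, hav, hb, hbw, rfl⟩ := exists_add_of_le_add hv hu hw huvw
      rw [happ, map_add, map_add] at hzero
      have := hμ0' a ha
      have := hμ0' b hb
      have := hν0' a ha
      have := hν0' b hb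
      rw [hμv a ha hav (by linarith), hνw b hb hbw (by linarith), add_zero]
  have hlub := hX.isLUB_of_dense hx hP0 hadd fun w hw hne hwx => by
    obtain ⟨μ, hμ, hμ0, hpos⟩ := hI.exists_pos hX hs hw hne
    obtain ⟨z, hz0, hzne, hzw, hz⟩ := exists_strictlyPositiveBelow hX μ.2 hμ0 hw hpos
    exact ⟨z, hz0, hzne, hzw, μ, hμ, hμ0, hz⟩
  have hmem : ∀ z ∈ {v | 0 ≤ v ∧ v ≤ x ∧ P v}, z ∈ D := by
    rintro z ⟨hz0, hzx, μ, hμ, hμ0, hz⟩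
    choose y hyD hy0 hyx hylt using fun n : ℕ =>
      happrox μ hμ hμ0 ((1 / 2 : ℝ) ^ n) (by positivity)
    -- Truncating at `z` keeps the approximants in `D` by solidity and loses no accuracy: `z - y n ⊓
    -- z ≤ x - y n`.
    refine hclosed _ _ z (orderConverges_of_strictlyPositiveBelow hX μ.2 hμ0 hz
      (y := fun n => y n ⊓ z) (fun n => ⟨le_inf (hy0 n) hz0, inf_le_right⟩) fun n => ?_)
      fun n => hsolid _ _ (le_inf (hy0 _) hz0) inf_le_left (hyD _)
    refine (map_mono_of_nonneg hμ0 ?_).trans (hylt n).le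
    rw [sub_inf, sub_self]
    exact sup_le (sub_le_sub_right hzx _) (sub_nonneg.2 (hyx n))
  have hne : {v | 0 ≤ v ∧ v ≤ x ∧ P v}.Nonempty := ⟨0, le_rfl, hx, hP0⟩
  have hdir := directedOn_le_of_add (x := x) hadd hmono
  have := hne.to_subtype
  have := directedOn_iff_isDirectedOrder.1 hdir
  exact hclosed _ _ x (orderConverges_of_isLUB hne hdir hlub) fun v => hmem _ v.2

end Closedness

/-! ### Hahn–Banach for a lattice seminorm -/

section Separation

variable {X : Type u} [AddCommGroup X] [Module ℝ X] [Lattice X] [IsOrderedAddMonoid X]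
  [IsOrderedModule ℝ X]

/-- The seminorm `x ↦ μ |x|` of a positive functional `μ`. -/
def latticeSeminorm (μ : X →ₗ[ℝ] ℝ) (hμ : ∀ x, 0 ≤ x → 0 ≤ μ x) : Seminorm ℝ X :=
  Seminorm.of (fun x => μ |x|)
    (fun x y => (map_mono_of_nonneg hμ (abs_add_le x y)).trans_eq (map_add _ _ _))
    (fun c x => by
      rcases le_total 0 c with hc | hc
      · rw [abs_smul_of_nonneg hc, map_smul, Real.norm_of_nonneg hc, smul_eq_mul]
      · rw [← abs_neg, ← neg_smul, abs_smul_of_nonneg (neg_nonneg.2 hc), map_smul,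
          Real.norm_of_nonpos hc, smul_eq_mul])

/-- Separation of a convex set from a point outside its closure for a seminorm. -/
theorem exists_separating_of_seminorm {E : Type*} [AddCommGroup E] [Module ℝ E] (p : Seminorm ℝ E)
    {C : Set E} (hC : Convex ℝ C) {x : E} {ε : ℝ} (hε : 0 < ε) (h : ∀ y ∈ C, ε ≤ p (y - x)) :
    ∃ (f : E →ₗ[ℝ] ℝ) (u : ℝ), (∃ K, 0 ≤ K ∧ ∀ y, |f y| ≤ K * p y) ∧ f x < u ∧ ∀ y ∈ C, u ≤ f y := by
  let _ : SeminormedAddCommGroup E := p.toSeminormedAddCommGroup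
  have hnorm : ∀ y : E, ‖y‖ = p y := fun y => rfl
  let _ : NormedSpace ℝ E := ⟨fun c y => (map_smul_eq_mul p c y).le⟩
  obtain ⟨f, u, hf, hu⟩ := geometric_hahn_banach_open (convex_ball x ε) Metric.isOpen_ball hC
    (Set.disjoint_left.2 fun y hy hyC => by
      rw [mem_ball_iff_norm] at hy
      exact (h y hyC).not_gt hy)
  exact ⟨f.toLinearMap, u, ⟨‖f‖, norm_nonneg f, fun y => f.le_opNorm y⟩,
    hf x (Metric.mem_ball_self hε), hu⟩

end Separation

/-! ### The surplus invariant case -/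

section LowerSemicontinuity

theorem WeakBilin.tendsto_of_forall_eval_tendsto {E F : Type*} [AddCommMonoid E] [Module ℝ E]
    [AddCommMonoid F] [Module ℝ F] {B : E →ₗ[ℝ] F →ₗ[ℝ] ℝ} {ι : Type*} {l : Filter ι}
    {f : ι → WeakBilin B} {a : WeakBilin B} (h : ∀ y, Tendsto (fun i => B (f i) y) l (𝓝 (B a y))) :
    Tendsto f l (𝓝 a) := by
  rw [nhds_induced, tendsto_comap_iff]
  exact tendsto_pi_nhds.2 h

variable {X : Type u} [AddCommGroup X] [Module ℝ X] [Lattice X]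

omit [Lattice X] in
theorem QuasiconvexFunctional.convex_le {ρ : X → EReal} (h : QuasiconvexFunctional ρ)
    (m : EReal) : Convex ℝ {x | ρ x ≤ m} := by
  intro x hx y hy a b ha hb hab
  obtain rfl : b = 1 - a := by linarith
  exact (h x y a ha (by linarith)).trans (max_le hx hy)

omit [Module ℝ X] in
theorem FatouProperty.mem_of_orderConverges {ρ : X → EReal} (h : FatouProperty ρ) {ι : Type u}
    [Preorder ι] [IsDirectedOrder ι] [Nonempty ι] {x : ι → X} {a : X} (hx : OrderConverges x a)
    {m : EReal} (hm : ∀ i, ρ (x i) ≤ m) : ρ a ≤ m :=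
  (h ι x a hx).trans ((liminf_le_liminf (Eventually.of_forall hm)).trans_eq (liminf_const m))

variable [IsOrderedAddMonoid X]

omit [Module ℝ X] in
theorem SuperFatouProperty.fatouProperty {ρ : X → EReal} (h : SuperFatouProperty ρ) :
    FatouProperty ρ := fun ι _ _ _ x a hx => h ι x a hx.uoConverges

omit [IsOrderedAddMonoid X] in
/-- Weak lower semicontinuity implies the Fatou property, since order convergent nets converge
weakly. -/
theorem SigmaLSC.fatouProperty {I : Submodule ℝ (orderContinuousDual X)} {ρ : X → EReal}
    (h : SigmaLSC I ρ) : FatouProperty ρ := by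
  intro ι _ _ _ x a hx
  have ht := WeakBilin.tendsto_of_forall_eval_tendsto (B := dualPairing I) (f := fun i => x i)
    (a := a) (l := atTop) fun φ => φ.1.2 ι x a hx
  refine le_of_forall_lt fun c hc => ?_
  obtain ⟨d, hcd, hd⟩ := exists_between hc
  exact hcd.trans_le (le_liminf_of_le (by isBoundedDefault)
    ((ht.eventually (h a d hd)).mono fun i hi => hi.le))

variable [IsOrderedModule ℝ X]

/-- A surplus invariant, monotone, quasiconvex functional with the Fatou property has sublevel sets
that are closed for the seminorms given by a separating ideal. -/
theorem FatouProperty.le_of_forall_exists_lt (hX : ArchimedeanLattice X) {ρ : X → EReal}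
    (hF : FatouProperty ρ) (hs : SurplusInvariant ρ) (hm : MonotoneFunctional ρ)
    {I : Submodule ℝ (orderContinuousDual X)} (hI : IsDualIdeal I) (hsep : SeparatesPoints I)
    {m : EReal} {a : X}
    (h : ∀ μ ∈ I, 0 ≤ μ → ∀ ε > 0, ∃ y, ρ y ≤ m ∧ μ.1 |y - a| < ε) : ρ a ≤ m := by
  rw [hs a]
  refine mem_of_forall_exists_lt hX hI hsep (D := {x | ρ (-x) ≤ m})
    (fun x y _ hyx hx => (hm _ _ (neg_le_neg hyx)).trans hx)
    (fun ι _ _ _ x b hx hD => hF.mem_of_orderConverges hx.neg hD) (negPart_nonneg a)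
    fun μ hμ hμ0 ε hε => ?_
  obtain ⟨y, hy, hlt⟩ := h μ hμ hμ0 ε hε
  refine ⟨y⁻ ⊓ a⁻, ?_, le_inf (negPart_nonneg y) (negPart_nonneg a), inf_le_right, ?_⟩
  · exact ((hm _ _ (neg_le_neg inf_le_left)).trans_eq (hs y).symm).trans hy
  · exact (map_mono_of_nonneg hμ0 ((sub_inf_le_abs_sub _ _).trans
      (abs_negPart_sub_negPart_le y a))).trans_lt hlt

theorem FatouProperty.sigmaLSC (hX : ArchimedeanLattice X) {ρ : X → EReal}
    (hF : FatouProperty ρ) (hq : QuasiconvexFunctional ρ) (hs : SurplusInvariant ρ)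
    (hm : MonotoneFunctional ρ) {I : Submodule ℝ (orderContinuousDual X)} (hI : IsDualIdeal I)
    (hsep : SeparatesPoints I) : SigmaLSC I ρ := by
  intro a m hma
  by_contra hcon
  refine hma.not_ge (hF.le_of_forall_exists_lt hX hs hm hI hsep fun μ hμ hμ0 ε hε => ?_)
  by_contra! hfar
  -- The sublevel set stays at `μ`-distance at least `ε` from `a`. The bound `|f x| ≤ K * μ |x|`
  -- makes the separating `f` order continuous and puts it in `I`, so `f < u` is a weak
  -- neighbourhood of `a` missing the sublevel set.
  obtain ⟨f, u, ⟨K, hK, hfK⟩, hfa, hfu⟩ := exists_separating_of_seminorm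
    (latticeSeminorm μ.1 hμ0) (hq.convex_le m) hε hfar
  have hKμ0 : ∀ x, 0 ≤ x → 0 ≤ (K • μ).1 x := fun x hx => mul_nonneg hK (hμ0 x hx)
  have hfO : OrderContinuousFunctional f :=
    OrderContinuousFunctional.of_abs_le hKμ0 (K • μ).2 hfK
  have hfI : (⟨f, hfO⟩ : orderContinuousDual X) ∈ I :=
    hI.mem_of_abs_le hX (I.smul_mem K hμ) hKμ0 fun x hx => by
      have := hfK x
      change |f x| ≤ K * μ.1 |x| at this
      rwa [abs_of_nonneg hx] at this
  have hcont : Continuous fun x : WeakBilin (dualPairing I) => f x :=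
    WeakBilin.eval_continuous (dualPairing I) ⟨⟨f, hfO⟩, hfI⟩
  refine hcon (((hcont.tendsto a).eventually_lt_const hfa).mono fun y hy => ?_)
  by_contra! hym
  exact (hfu y hym).not_gt hy

omit [Module ℝ X] [IsOrderedModule ℝ X] in
theorem FatouProperty.superFatouProperty {ρ : X → EReal} (hF : FatouProperty ρ)
    (hs : SurplusInvariant ρ) (hm : MonotoneFunctional ρ) : SuperFatouProperty ρ := by
  intro ι _ _ _ x a hx
  have hc : OrderConverges (fun i => -((x i)⁻ ⊓ a⁻)) (-a⁻) := by
    refine (hx a⁻ (negPart_nonneg a)).of_abs_sub_le fun i => ?_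
    rw [sub_zero, abs_of_nonneg (le_inf (abs_nonneg _) (negPart_nonneg a)), neg_sub_neg,
      abs_of_nonneg (sub_nonneg.2 inf_le_right)]
    exact le_inf ((sub_inf_le_abs_sub _ _).trans (abs_negPart_sub_negPart_le _ _))
      (sub_le_self _ (le_inf (negPart_nonneg _) (negPart_nonneg a)))
  rw [hs a]
  refine (hF ι _ _ hc).trans (liminf_le_liminf (Eventually.of_forall fun i => ?_))
  rw [hs (x i)]
  exact hm _ _ (neg_le_neg inf_le_left)

omit [IsOrderedModule ℝ X] in
/-- The equivalences, from the two implications that depend on the class of functionals. -/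
theorem fatouProperty_equivalences {ρ : X → EReal} (hsuper : FatouProperty ρ → SuperFatouProperty ρ)
    (hlsc : FatouProperty ρ → ∀ I : Submodule ℝ (orderContinuousDual X),
      IsDualIdeal I → SeparatesPoints I → SigmaLSC I ρ) :
    (FatouProperty ρ ↔ SuperFatouProperty ρ) ∧
      (SeparatesPoints (⊤ : Submodule ℝ (orderContinuousDual X)) →
        [FatouProperty ρ,
          SuperFatouProperty ρ,
          ∀ I : Submodule ℝ (orderContinuousDual X),
            IsDualIdeal I → SeparatesPoints I → SigmaLSC I ρ,
          ∃ I : Submodule ℝ (orderContinuousDual X),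
            IsDualIdeal I ∧ SeparatesPoints I ∧ SigmaLSC I ρ].TFAE) := by
  refine ⟨⟨hsuper, fun h => h.fatouProperty⟩, fun hsep => ?_⟩
  tfae_have 1 → 2 := hsuper
  tfae_have 2 → 1 := fun h => h.fatouProperty
  tfae_have 1 → 3 := hlsc
  tfae_have 3 → 4 := fun h =>
    have htop : IsDualIdeal (⊤ : Submodule ℝ (orderContinuousDual X)) :=
      fun _ _ _ _ _ _ _ _ => Submodule.mem_top
    ⟨⊤, htop, hsep, h ⊤ htop hsep⟩
  tfae_have 4 → 1 := fun ⟨_, _, _, h⟩ => h.fatouProperty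
  tfae_finish

end LowerSemicontinuity

/-! ### Reduction of the `S`-additive case to `max (ρ x) 0` -/

section SAdditive

variable {X : Type u} [AddCommGroup X] [Module ℝ X] [Lattice X] {ρ : X → EReal}

omit [AddCommGroup X] [Module ℝ X] in
theorem MonotoneFunctional.max_zero (h : MonotoneFunctional ρ) :
    MonotoneFunctional fun x => max (ρ x) 0 := fun x y hxy => max_le_max_right 0 (h x y hxy)

omit [Lattice X] in
theorem ConvexFunctional.quasiconvexFunctional_max_zero (h : ConvexFunctional ρ) :
    QuasiconvexFunctional fun x => max (ρ x) 0 := by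
  intro x y t h0 h1
  refine max_le ((h x y t h0 h1).trans ?_) ((le_max_right _ _).trans (le_max_left _ _))
  set M := max (max (ρ x) 0) (max (ρ y) 0) with hM
  have ht : (0 : EReal) ≤ (t : EReal) := by exact_mod_cast h0
  have ht' : (0 : EReal) ≤ ((1 - t : ℝ) : EReal) := by exact_mod_cast sub_nonneg.2 h1
  calc (t : EReal) * ρ x + ((1 - t : ℝ) : EReal) * ρ y
      ≤ (t : EReal) * M + ((1 - t : ℝ) : EReal) * M :=
        add_le_add (mul_le_mul_of_nonneg_left ((le_max_left _ _).trans (le_max_left _ _)) ht)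
          (mul_le_mul_of_nonneg_left ((le_max_left _ _).trans (le_max_right _ _)) ht')
    _ = ((t : EReal) + ((1 - t : ℝ) : EReal)) * M :=
        (EReal.right_distrib_of_nonneg ht ht').symm
    _ = M := by
        rw [← EReal.coe_add, add_sub_cancel, EReal.coe_one, one_mul]

omit [Module ℝ X] in
theorem FatouProperty.max_zero (h : FatouProperty ρ) :
    FatouProperty fun x => max (ρ x) 0 := by
  intro ι _ _ _ x a hx
  refine max_le ((h ι x a hx).trans ?_) ?_
  · exact liminf_le_liminf (Eventually.of_forall fun i => le_max_left _ _)
  · exact le_liminf_of_le (by isBoundedDefault) (Eventually.of_forall fun i => le_max_right _ _)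

omit [Lattice X] in
theorem SAdditive.le_iff {S : X} (h : SAdditive S ρ) (x : X) (c : ℝ) :
    ρ x ≤ c ↔ max (ρ (x + c • S)) 0 ≤ 0 := by
  rw [h, max_le_iff, and_iff_left le_rfl]
  exact (EReal.sub_nonpos).symm

omit [Lattice X] in
theorem SAdditive.lt_iff {S : X} (h : SAdditive S ρ) (x : X) (c : ℝ) :
    (c : EReal) < ρ x ↔ 0 < max (ρ (x + c • S)) 0 := by
  rw [← not_le, h.le_iff, not_le]

variable [IsOrderedAddMonoid X]

theorem SurplusInvariantSubjectToPositivity.surplusInvariant_max_zero [IsOrderedModule ℝ X] {S : X}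
    (hS : 0 ≤ S) (hρ : ∀ x, ρ x ≠ ⊥) (h : SurplusInvariantSubjectToPositivity ρ)
    (hadd : SAdditive S ρ) (hm : MonotoneFunctional ρ) :
    SurplusInvariant fun x => max (ρ x) 0 := by
  intro x
  rcases lt_or_ge 0 (ρ x) with hx | hx
  · exact congrArg (fun r => max r 0) (h x hx)
  dsimp only
  rw [max_eq_right hx, eq_comm, max_eq_right_iff]
  refine EReal.le_of_forall_lt_iff_le.1 fun ε hε => ?_
  -- When `ρ x = r ≤ 0`, shifting by `(r - ε) • S` raises the value to exactly `ε > 0`, where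
  -- surplus invariance applies. The shift is downward, so it enlarges the negative part and
  -- monotonicity yields `ρ (-x⁻) ≤ ε`.
  have hε' : 0 < ε := by exact_mod_cast hε
  lift ρ x to ℝ using ⟨(hx.trans_lt (EReal.coe_lt_top 0)).ne, hρ x⟩ with r hr
  have hr0 : r ≤ 0 := by exact_mod_cast hx
  have h1 : ρ (x + (r - ε) • S) = ε := by
    rw [hadd, ← hr, ← EReal.coe_sub, sub_sub_cancel]
  have h2 : (0 : EReal) < ρ (x + (r - ε) • S) := by rw [h1]; exact hε
  rw [← h1, h _ h2]
  refine hm _ _ (neg_le_neg (negPart_anti ?_))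
  rw [add_le_iff_nonpos_right]
  exact smul_nonpos_of_nonpos_of_nonneg (by linarith) hS

theorem SAdditive.superFatouProperty {S : X} (hadd : SAdditive S ρ)
    (h : SuperFatouProperty fun x => max (ρ x) 0) : SuperFatouProperty ρ := by
  intro ι _ _ _ x a hx
  by_contra! hlt
  -- Only a real level can be moved to zero by a translation, so a real `c` is inserted in the gap.
  obtain ⟨c, h1, h2⟩ := EReal.lt_iff_exists_real_btwn.1 hlt
  have h3 := h ι (fun i => x i + c • S) (a + c • S) (hx.of_abs_sub_le fun i => by simp)
  have h4 := ((hadd.lt_iff a c).1 h2).trans_le h3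
  refine h1.not_ge (le_liminf_of_le (by isBoundedDefault)
    ((eventually_lt_of_lt_liminf h4).mono fun i hi => ((hadd.lt_iff _ c).2 hi).le))

omit [IsOrderedAddMonoid X] in
theorem SAdditive.sigmaLSC {S : X} (hadd : SAdditive S ρ)
    {I : Submodule ℝ (orderContinuousDual X)} (h : SigmaLSC I fun x => max (ρ x) 0) :
    SigmaLSC I ρ := by
  intro a m hma
  obtain ⟨c, h1, h2⟩ := EReal.lt_iff_exists_real_btwn.1 hma
  let T : WeakBilin (dualPairing I) := c • (S : X)
  have hc : Continuous fun x : WeakBilin (dualPairing I) => x + T := continuous_id.add continuous_const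
  exact ((hc.tendsto a).eventually (h _ _ ((hadd.lt_iff a c).1 h2))).mono fun y hy =>
    h1.trans ((hadd.lt_iff y c).2 hy)

end SAdditive

theorem mainTheorem4 {X : Type*} [AddCommGroup X] [Module ℝ X] [Lattice X]
    [IsOrderedAddMonoid X] [IsOrderedModule ℝ X] (hX : ArchimedeanLattice X) :
    (∀ ρ : X → EReal, (∀ x, ρ x ≠ ⊥) →
      QuasiconvexFunctional ρ → SurplusInvariant ρ → MonotoneFunctional ρ →
        (FatouProperty ρ ↔ SuperFatouProperty ρ) ∧
        (SeparatesPoints (⊤ : Submodule ℝ (orderContinuousDual X)) →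
          [FatouProperty ρ,
            SuperFatouProperty ρ,
            ∀ I : Submodule ℝ (orderContinuousDual X),
              IsDualIdeal I → SeparatesPoints I → SigmaLSC I ρ,
            ∃ I : Submodule ℝ (orderContinuousDual X),
              IsDualIdeal I ∧ SeparatesPoints I ∧ SigmaLSC I ρ].TFAE)) ∧
    (∀ S : X, 0 ≤ S → S ≠ 0 → ∀ ρ : X → EReal, (∀ x, ρ x ≠ ⊥) →
      ConvexFunctional ρ → SAdditive S ρ → MonotoneFunctional ρ →
      SurplusInvariantSubjectToPositivity ρ →
        (FatouProperty ρ ↔ SuperFatouProperty ρ) ∧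
        (SeparatesPoints (⊤ : Submodule ℝ (orderContinuousDual X)) →
          [FatouProperty ρ,
            SuperFatouProperty ρ,
            ∀ I : Submodule ℝ (orderContinuousDual X),
              IsDualIdeal I → SeparatesPoints I → SigmaLSC I ρ,
            ∃ I : Submodule ℝ (orderContinuousDual X),
              IsDualIdeal I ∧ SeparatesPoints I ∧ SigmaLSC I ρ].TFAE)) := by
  refine ⟨fun ρ _ hq hs hm => ?_, fun S hS _ ρ hρ hc hadd hm hs => ?_⟩
  · exact fatouProperty_equivalences (fun h => h.superFatouProperty hs hm)
      fun h I hI hsep => h.sigmaLSC hX hq hs hm hI hsep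
  · have hs' := hs.surplusInvariant_max_zero hS hρ hadd hm
    exact fatouProperty_equivalences
      (fun h => hadd.superFatouProperty (h.max_zero.superFatouProperty hs' hm.max_zero))
      fun h I hI hsep => hadd.sigmaLSC (h.max_zero.sigmaLSC hX hc.quasiconvexFunctional_max_zero
        hs' hm.max_zero hI hsep)
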